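/- **Model.** Let $G=(V,E)$ be a finite undirected graph. An $(n,k)$-decomposition of $G$ is a partition of its nodes into input nodes $I_1\cup\dots\cup I_k$ (those of each $I_j$ being numbered) and auxiliary nodes $A_0\cup A_1\cup\dots\cup A_k$ such that, for $j=1,\dots,k$, $|I_j|=n$ and every neighbour of a node of $I_j$ lies in $I_j\cup A_j$. The input is $x=(x_1,\dots,x_k)\in(\{0,1\}^n)^k$: the nodes of $I_j$ hold the bits of $x_j$, and the auxiliary nodes hold fixed arbitrary bits. A protocol $\Pi$ with $T\ge 1$ transmissions is given by a sequence of nodes $v_1,\dots,v_T$ (independent of the input) and message functions. At step $t$, node $v_t$ sends one bit, which is a function of its own bit, of the bits it has received so far, and of internal randomness of the protocol. Each neighbour of $v_t$ receives this bit xored with a noise bit that equals $1$ with probability $\epsilon$; all noise bits are independent of each other and of everything else. The bit computed by $v_T$ at step $T$ is the output; it counts as a transmission, and the node $v_T$ that declares it is an auxiliary node. $\Pi$ is an $\epsilon$-noise $(n,k,d,D)$-protocol if each input node makes at most $d$ transmissions and, for $j=1,\dots,k$, the nodes of $I_j\cup A_j$ together make at most $D$ transmissions. **Trees.** An $(n,1,D,\epsilon)$-xnd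 tree is a decision tree all of whose leaves are at the same depth, at most $D$. Each internal node $v$ carries an element $\lambda_v$ of a finite index set $\Lambda$ and a function $g'_v$ from $\{0,1\}^n$ to the finite set of children of $v$. On input $x\in\{0,1\}^n$, vectors $z_\lambda\in\{0,1\}^n$ $(\lambda\in\Lambda)$ are drawn, whose bits are all independent and equal to $1$ with probability $\epsilon$. From $v$ the computation moves to the child $g'_v(x\oplus z_{\lambda_v})$, and the result is the leaf reached. **Advantage.** Let $\oplus(x)\in\{+1,-1\}$ be the parity of all bits of $x$, as a sign. The advantage for parity, under an input law $\nu$, of a randomized algorithm $\mathcal A$ with outputs in a set $C$ is $\mathsf{adv}_{\oplus,\nu}(\mathcal A)=\sup_{a:C\to[-1,1]}|\mathrm{E}[\oplus(X)\,a(\mathcal A(X))]|$, where $X$ has law $\nu$ and the expectation is also over the randomness of $\mathcal A$ (including the noise). For a distribution $\mu$ on $\{0,1\}^n$, let $\alpha_\mu(n,D,\epsilon)=\sup_{\mathcal T}\mathsf{adv}_{\oplus,\mu}(\mathcal T)$ over all $(n,1,D,\epsilon)$-xnd trees $\mathcal T$, and let $\alpha^{\rm bin}_\mu(n,D,\epsilon)$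 be the same supremum over those trees in which every internal node has exactly two children. **Lemma.** Let $0\le\epsilon\le 1/2$. For every distribution $\mu$ on $\{0,1\}^n$ and every $\epsilon$-noise $(n,k,d,D)$-protocol $\Pi$ as above, $$\mathsf{adv}_{\oplus,\mu^k}(\Pi)\le\alpha_\mu(n,3D,\epsilon^d)^k ,$$ and moreover $\mathsf{adv}_{\oplus,\mu^k}(\Pi)\le\alpha^{\rm bin}_\mu(n,3D,\epsilon^d)^k$. -/

import Mathlib

/-! ### Independent bits -/

/-- The law of a family `(X_i)_{i : ι}` of independent random variables, each with law `p`. -/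
noncomputable def iidLaw {α : Type*} [Fintype α] (p : PMF α) (ι : Type*) [Fintype ι]
    [DecidableEq ι] : PMF (ι → α) :=
  PMF.ofFintype (fun x => ∏ i, p (x i)) (by
    have h : ∑ a, p a = 1 := (tsum_fintype (fun a => p a)).symm.trans p.tsum_coe
    rw [← Fintype.prod_sum]
    simp [h])

/-- The law of an `ε`-noisy bit: `true` with probability `ε`, `false` with probability `1 - ε`. -/
noncomputable def noisyBit (ε : unitInterval) : PMF Bool :=
  PMF.ofFintype (fun b => ENNReal.ofReal (if b then (ε : ℝ) else 1 - (ε : ℝ))) (by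
    rw [Fintype.sum_bool]
    simp only [if_true, Bool.false_eq_true, if_false]
    rw [← ENNReal.ofReal_add ε.2.1 (sub_nonneg.2 ε.2.2)]
    simp)

/-- The joint law of two independent random variables with laws `p` and `q`. -/
noncomputable def indepPair {α β : Type*} (p : PMF α) (q : PMF β) : PMF (α × β) :=
  p.bind fun a => q.map fun b => (a, b)

/-! ### Advantage -/

/-- The advantage, for `f` under the input law `μ`, of the randomized algorithm which on input `x`
draws internal randomness `w` with law `ν` (independently of the input) and outputs `A x w`:
the supremum over `a : C → [-1, 1]` of `|E[f(X) a(A(X))]|`. -/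
noncomputable def advantage {S Ω C : Type*} [Fintype S] [Fintype Ω]
    (f : S → ℝ) (μ : PMF S) (ν : PMF Ω) (A : S → Ω → C) : ℝ :=
  ⨆ a : C → Set.Icc (-1 : ℝ) 1,
    |∑ x, ∑ w, (μ x).toReal * (ν w).toReal * (f x * (a (A x w) : ℝ))|

/-- The parity of the `n * k` bits of `x ∈ ({0,1}^n)^k`, as a sign: `-1` if the number of ones is
odd and `1` if it is even. -/
def paritySign {n k : ℕ} (x : Fin k → Fin n → Bool) : ℝ :=
  ∏ j, ∏ i, if x j i then (-1 : ℝ) else 1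

/-! ### Noisy communication protocols -/

/-- A protocol on the network `G`. At step `t` the sensor `sender t` sends one bit, computed by
`message t` from the internal randomness of the protocol (an element of `R`), the input bit of the
sender, and the noisy copies which the sender received of the bits sent at the earlier steps `s` by
its neighbours. The last message, at step `cost - 1`, is the answer, declared by the sensor that
computes it. -/
structure NoisyProtocol {V : Type*} (G : SimpleGraph V) (R : Type*) where
  cost : ℕ
  cost_pos : 0 < cost
  sender : Fin cost → V
  randomness : PMF R
  message : (t : Fin cost) → R → Bool →
    ({s : Fin cost // s < t ∧ G.Adj (sender s) (sender t)} → Bool) → Bool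

namespace NoisyProtocol

variable {V : Type*} {G : SimpleGraph V} {R : Type*} (P : NoisyProtocol G R)

/-- The step at which the answer is declared. -/
def lastStep : Fin P.cost := ⟨P.cost - 1, Nat.sub_lt P.cost_pos Nat.one_pos⟩

/-- The bit sent at step `t`, when the internal randomness is `ρ`, the input bit of `v` is
`input v`, and the copy of the `s`-th transmission received by a neighbour `w` of its sender is
xored with the noise bit `η (w, s)`. -/
def sentBit (ρ : R) (input : V → Bool) (η : V × Fin P.cost → Bool) (t : Fin P.cost) : Bool :=
  P.message t ρ (input (P.sender t))
    (fun s => xor (sentBit ρ input η s.1) (η (P.sender t, s.1)))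
termination_by t
decreasing_by exact s.2.1

end NoisyProtocol

/-- An `(n,k)`-decomposition of a network `G`, with a numbering of its input nodes.
The `i`-th node of `I_j` is `inputNode j i`, and `cluster v` is `some j` for the nodes `v` of
`I_j ∪ A_j` and `none` for the nodes of `A_0`; the auxiliary nodes are those which are not input
nodes. So `I_1, …, I_k, A_0, A_1, …, A_k` partition the nodes, `I_j` has exactly `n` elements, and
all neighbours of nodes of `I_j` lie in `I_j ∪ A_j`. -/
structure NetworkDecomposition {V : Type*} (G : SimpleGraph V) (n k : ℕ) where
  inputNode : Fin k → Fin n → V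
  inputNode_injective : Function.Injective (fun p : Fin k × Fin n => inputNode p.1 p.2)
  cluster : V → Option (Fin k)
  cluster_inputNode : ∀ j i, cluster (inputNode j i) = some j
  cluster_neighbor : ∀ j i w, G.Adj (inputNode j i) w → cluster w = some j

namespace NetworkDecomposition

variable {V : Type*} {G : SimpleGraph V} {n k : ℕ} (N : NetworkDecomposition G n k)

/-- Auxiliary nodes are the nodes that receive no input. -/
def IsAux (v : V) : Prop := ∀ j i, N.inputNode j i ≠ v

/-- The bits held by all nodes on input `x ∈ ({0,1}^n)^k`: the `i`-th node of `I_j` holds `x j i`,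
and an auxiliary node `v` holds the fixed bit `aux v`. -/
noncomputable def extendInput (aux : V → Bool) (x : Fin k → Fin n → Bool) : V → Bool :=
  Function.extend (fun p : Fin k × Fin n => N.inputNode p.1 p.2) (fun p => x p.1 p.2) aux

/-- `P` is `(d,D)`-bounded: each input node makes at most `d` transmissions, and for each `j` all
nodes of `I_j ∪ A_j` together make at most `D` transmissions. -/
def IsBounded {R : Type*} (P : NoisyProtocol G R) (d D : ℕ) : Prop :=
  (∀ j i, Set.ncard {t : Fin P.cost | P.sender t = N.inputNode j i} ≤ d) ∧
  (∀ j, Set.ncard {t : Fin P.cost | N.cluster (P.sender t) = some j} ≤ D)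

end NetworkDecomposition

/-- The advantage for parity, under the law `μ` on `({0,1}^n)^k`, of the protocol `P` run with
`ε`-noise on a decomposed network whose auxiliary nodes hold the fixed bits `aux`. -/
noncomputable def protocolAdvantage {V R : Type*} [Fintype V] [DecidableEq V] [Fintype R]
    {G : SimpleGraph V} {n k : ℕ} (N : NetworkDecomposition G n k) (aux : V → Bool)
    (P : NoisyProtocol G R) (ε : unitInterval) (μ : PMF (Fin k → Fin n → Bool)) : ℝ :=
  advantage paritySign μ (indepPair P.randomness (iidLaw (noisyBit ε) (V × Fin P.cost)))
    (fun x w => P.sentBit w.1 (N.extendInput aux x) w.2 P.lastStep)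

/-! ### Xored-noise decision trees -/

/-- Oblivious xored-noise decision trees on `({0,1}^n)^k` with noise index set `Λ`. The index
`[i_1, …, i_r]` lists the blocks queried at the levels of the tree, starting from the root. A node
at a level that queries block `i` carries a noise index `lam` and a function `g` to its (finite,
arbitrarily large) set of children; the computation moves to the child
`g (x_i ⊕ z_{i, lam})`. -/
inductive XndTree (n k : ℕ) (Λ : Type) : List (Fin k) → Type
  | leaf : XndTree n k Λ []
  | node (i : Fin k) (l : List (Fin k)) (lam : Λ) (c : ℕ) (g : (Fin n → Bool) → Fin c)
      (child : Fin c → XndTree n k Λ l) : XndTree n k Λ (i :: l)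

namespace XndTree

/-- The leaf reached on input `x` and noise `z`, named by the path that leads to it. -/
def eval {n k : ℕ} {Λ : Type} : {l : List (Fin k)} → XndTree n k Λ l →
    (Fin k → Fin n → Bool) → (Fin k × Λ × Fin n → Bool) → List ℕ
  | _, leaf, _, _ => []
  | _, node i _ lam _ g child, x, z =>
      (g fun r => xor (x i r) (z (i, lam, r))).val ::
        (child (g fun r => xor (x i r) (z (i, lam, r)))).eval x z

/-- Every query of the tree has two possible outcomes. -/
def IsBinary {n k : ℕ} {Λ : Type} : {l : List (Fin k)} → XndTree n k Λ l → Prop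
  | _, leaf => True
  | _, node _ _ _ c _ child => c = 2 ∧ ∀ b, (child b).IsBinary

/-- The advantage of a tree for parity under the law `μ` on `({0,1}^n)^k`, when each `z_{i,λ}`
consists of `n` independent `ε`-noisy bits, independently for all `i` and `λ`. -/
noncomputable def parityAdvantage {n k : ℕ} {Λ : Type} [Fintype Λ] [DecidableEq Λ]
    {l : List (Fin k)} (T : XndTree n k Λ l) (ε : unitInterval)
    (μ : PMF (Fin k → Fin n → Bool)) : ℝ :=
  advantage paritySign μ (iidLaw (noisyBit ε) (Fin k × Λ × Fin n)) T.eval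

end XndTree

/-- `α_μ(n,D,ε)`: the best advantage for parity under `μ` of a single-block xored-noise decision
tree with noise `ε` that queries its block at most `D` times. -/
noncomputable def xndAdvantage {n : ℕ} (μ : PMF (Fin n → Bool)) (D : ℕ) (ε : unitInterval) : ℝ :=
  sSup {r | ∃ (m : ℕ) (l : List (Fin 1)) (T : XndTree n 1 (Fin m) l),
    (∀ i, l.count i ≤ D) ∧ r = T.parityAdvantage ε (iidLaw μ (Fin 1))}

/-- The best advantage as in `xndAdvantage`, over those trees all of whose queries have two
possible outcomes. -/
noncomputable def binaryXndAdvantage {n : ℕ} (μ : PMF (Fin n → Bool)) (D : ℕ)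
    (ε : unitInterval) : ℝ :=
  sSup {r | ∃ (m : ℕ) (l : List (Fin 1)) (T : XndTree n 1 (Fin m) l),
    (∀ i, l.count i ≤ D) ∧ T.IsBinary ∧ r = T.parityAdvantage ε (iidLaw μ (Fin 1))}

/-!
Write the message of each step of a protocol as a function `Bool → Bool` of the sender's own bit.
Call the sequence `τ` of these functions the transcript. The final answer is declared by an
auxiliary node, whose bit is fixed, so it is a function of `τ`; and for fixed `τ` the
probability that `τ` arises is that of a system of constraints which are no longer adaptive: at each
step, the sender's message function must be the right one, given the noisy copies it receives of bits
that are prescribed by `τ` and the input.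

For fixed `τ` the noise may therefore be resampled. A bit that does not depend on its sender gets
fresh noise. A bit sent by an input node that does depend on it is that node's input bit up to a
negation, so its noise may be put on the input bit; and at most `d` independent `ε`-noisy copies of a
bit can be produced from one `ε ^ d`-noisy copy (`exists_common_noise`), because any outcome of at
most `d` noise bits has probability at least `ε ^ d`. So each node `w` of the `j`-th cluster acts on
`x_j ⊕ z_w`, where `z_w` consists of independent `ε ^ d`-noisy bits, and on randomness that is
independent of the input (`exists_transcript_simulation`). With that randomness fixed, the
correlation of the parity with `τ` is a product of one factor for each cluster, because the input
nodes have neighbours in their own cluster only (`sum_sum_eq_prod_clusterFactor`).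

It remains to bound the sum over `τ` of the absolute value of this product. Each step belongs to
one factor; if that factor is summed over the moves at the step while the others are bounded by
their maxima, the sum of the products is at most the product of the values of `k` separate games
(`sum_prod_le_prod_gameValue`). In each game the moves outside the cluster are chosen optimally, so
its value is attained by an xored-noise tree, which finds the message function at each step of
the cluster by two binary queries with the noise index of the sender (`exists_tree_gameValue_le`).
This takes at most `2 * D` queries.
-/

/-! ### Weights of noise vectors -/

/-- The probability that a `q`-noisy bit equals `b`. -/
noncomputable def bitWeight (q : ℝ) (b : Bool) : ℝ := if b then q else 1 - q

/-- The probability that a family of independent `q`-noisy bits equals `η`. -/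
noncomputable def bitsWeight {ι : Type*} [Fintype ι] (q : ℝ) (η : ι → Bool) : ℝ :=
  ∏ i, bitWeight q (η i)

/-- The number `1` if `p` holds, and `0` otherwise. -/
noncomputable def propInd (p : Prop) : ℝ := open Classical in if p then 1 else 0

theorem propInd_true {p : Prop} (h : p) : propInd p = 1 := by simp [propInd, h]

theorem propInd_false {p : Prop} (h : ¬p) : propInd p = 0 := by simp [propInd, h]

theorem propInd_and (p q : Prop) : propInd (p ∧ q) = propInd p * propInd q := by
  by_cases hp : p <;> by_cases hq : q <;> simp [propInd, hp, hq]

theorem propInd_forall {ι : Type*} [Fintype ι] (p : ι → Prop) :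
    propInd (∀ i, p i) = ∏ i, propInd (p i) := by
  by_cases h : ∀ i, p i
  · rw [propInd_true h, Finset.prod_eq_one fun i _ => propInd_true (h i)]
  · rw [propInd_false h]
    push Not at h
    obtain ⟨i, hi⟩ := h
    exact (Finset.prod_eq_zero (Finset.mem_univ i) (propInd_false hi)).symm

theorem bitWeight_nonneg {q : ℝ} (h0 : 0 ≤ q) (h1 : q ≤ 1) (b : Bool) : 0 ≤ bitWeight q b := by
  cases b <;> simp [bitWeight, h0, h1]

theorem bitWeight_not (q : ℝ) (b : Bool) : bitWeight q (!b) = 1 - bitWeight q b := by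
  cases b <;> simp [bitWeight]

theorem bitWeight_le_one {q : ℝ} (h0 : 0 ≤ q) (h1 : q ≤ 1) (b : Bool) : bitWeight q b ≤ 1 := by
  cases b <;> simp [bitWeight, h0, h1]

theorem bitsWeight_nonneg {ι : Type*} [Fintype ι] {q : ℝ} (h0 : 0 ≤ q) (h1 : q ≤ 1)
    (η : ι → Bool) : 0 ≤ bitsWeight q η :=
  Finset.prod_nonneg fun i _ => bitWeight_nonneg h0 h1 (η i)

theorem sum_bitsWeight (ι : Type*) [Fintype ι] [DecidableEq ι] (q : ℝ) :
    ∑ η : ι → Bool, bitsWeight q η = 1 := by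
  unfold bitsWeight
  rw [← Fintype.prod_sum]
  simp [bitWeight]

theorem noisyBit_toReal (ε : unitInterval) (b : Bool) :
    (noisyBit ε b).toReal = bitWeight ε b := by
  unfold noisyBit bitWeight
  rw [PMF.ofFintype_apply, ENNReal.toReal_ofReal]
  cases b
  · simpa using ε.2.2
  · simpa using ε.2.1

theorem iidLaw_toReal {α : Type*} [Fintype α] (p : PMF α) (ι : Type*) [Fintype ι]
    [DecidableEq ι] (x : ι → α) : (iidLaw p ι x).toReal = ∏ i, (p (x i)).toReal := by
  unfold iidLaw
  rw [PMF.ofFintype_apply, ENNReal.toReal_prod]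

theorem iidLaw_noisyBit_toReal (ε : unitInterval) (ι : Type*) [Fintype ι]
    [DecidableEq ι] (η : ι → Bool) :
    (iidLaw (noisyBit ε) ι η).toReal = bitsWeight ε η := by
  rw [iidLaw_toReal]
  exact Finset.prod_congr rfl fun i _ => noisyBit_toReal ε _

theorem indepPair_toReal {α β : Type*} (p : PMF α) (q : PMF β) (a : α) (b : β) :
    (indepPair p q (a, b)).toReal = (p a).toReal * (q b).toReal := by
  have h : indepPair p q (a, b) = p a * q b := by
    classical
    unfold indepPair
    rw [PMF.bind_apply, tsum_eq_single a]
    · rw [PMF.map_apply, tsum_eq_single b]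
      · simp
      · intro b' hb'
        simp [Ne.symm hb']
    · intro a' ha'
      rw [PMF.map_apply]
      simp [Ne.symm ha']
  rw [h, ENNReal.toReal_mul]

theorem sum_toReal {α : Type*} [Fintype α] (p : PMF α) : ∑ a, (p a).toReal = 1 := by
  rw [← ENNReal.toReal_sum fun a _ => p.apply_ne_top a, ← tsum_fintype (L := .unconditional _),
    p.tsum_coe, ENNReal.toReal_one]

/-! ### Simulating many slightly noisy bits by one very noisy bit -/

/-- At most `d` independent `ε`-noisy bits have the law of `(b ⊕ ξ_s)_s`, where `b` is an
`ε ^ d`-noisy bit, and `ξ` is independent of `b` with weights `K`. -/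
theorem exists_common_noise {A : Type*} [Fintype A] {ε : ℝ} (h0 : 0 ≤ ε) (h2 : ε ≤ 1 / 2) {d : ℕ}
    (hA : Fintype.card A ≤ d) :
    ∃ K : (A → Bool) → ℝ, (∀ ξ, 0 ≤ K ξ) ∧
      ∀ η, bitsWeight ε η = ∑ b, bitWeight (ε ^ d) b * K fun s => xor (η s) b := by
  have h1 : ε ≤ 1 := by linarith
  set q := ε ^ d with hq
  set flip : (A → Bool) → A → Bool := fun η s => !η s with hflip
  have hff : ∀ η, flip (flip η) = η := fun η => by simp [hflip]
  have hsum : ∀ (K : (A → Bool) → ℝ) η,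
      (∑ b, bitWeight q b * K fun s => xor (η s) b) = q * K (flip η) + (1 - q) * K η := by
    intro K η
    simp [bitWeight, hflip]
  simp only [hsum]
  by_cases hhalf : q = 1 / 2
  · -- Here `ε = 1 / 2`; conditioning the uniform vector `η` on a fixed bit gives `ξ`.
    have hε : ε = 1 / 2 := by
      have hd : d ≠ 0 := by
        rintro rfl
        norm_num [hq] at hhalf
      have := pow_le_of_le_one h0 h1 hd
      rw [← hq, hhalf] at this
      linarith
    have hP : ∀ η : A → Bool, bitsWeight ε (flip η) = bitsWeight ε η := by
      intro η
      refine Finset.prod_congr rfl fun s _ => ?_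
      rw [hflip, bitWeight_not, hε]
      cases η s <;> norm_num [bitWeight]
    cases isEmpty_or_nonempty A with
    | inl h =>
      refine ⟨bitsWeight ε, bitsWeight_nonneg h0 h1, fun η => ?_⟩
      rw [hP]
      ring
    | inr h =>
      obtain ⟨s⟩ := h
      refine ⟨fun η => if η s then 0 else 2 * bitsWeight ε η, fun η => ?_, fun η => ?_⟩
      · have := bitsWeight_nonneg h0 h1 η
        dsimp only
        split_ifs <;> linarith
      · dsimp only
        rw [hP, hhalf]
        cases h : η s
        · simp [hflip, h]
          ring
        · simp [hflip, h]
  · have hne : 1 - 2 * q ≠ 0 := fun h => hhalf (by linarith)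
    refine ⟨fun η => ((1 - q) * bitsWeight ε η - q * bitsWeight ε (flip η)) / (1 - 2 * q),
      fun η => ?_, fun η => ?_⟩
    · cases isEmpty_or_nonempty A with
      | inl h =>
        have : flip η = η := Subsingleton.elim _ _
        dsimp only
        rw [this, ← sub_mul, show 1 - q - q = 1 - 2 * q by ring, mul_div_cancel_left₀ _ hne]
        exact bitsWeight_nonneg h0 h1 η
      | inr h =>
        obtain ⟨s⟩ := h
        have hd : d ≠ 0 := by
          have : 0 < Fintype.card A := Fintype.card_pos_iff.2 ⟨s⟩
          omega
        have hqε : q ≤ ε := pow_le_of_le_one h0 h1 hd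
        -- Both weights are at most the weight of the bit at `s`, so they sum to at most `1`.
        have hle : ∀ ζ : A → Bool, bitsWeight ε ζ ≤ bitWeight ε (ζ s) := by
          intro ζ
          classical
          unfold bitsWeight
          rw [← Finset.mul_prod_erase _ _ (Finset.mem_univ s)]
          exact mul_le_of_le_one_right (bitWeight_nonneg h0 h1 _)
            (Finset.prod_le_one (fun i _ => bitWeight_nonneg h0 h1 _)
              fun i _ => bitWeight_le_one h0 h1 _)
        have hsumle : bitsWeight ε η + bitsWeight ε (flip η) ≤ 1 := by
          have h3 := hle η
          have h4 := hle (flip η)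
          rw [hflip, bitWeight_not] at h4
          linarith
        have hqle : q ≤ bitsWeight ε η := by
          calc q ≤ ε ^ Fintype.card A := pow_le_pow_of_le_one h0 h1 hA
            _ = ∏ _s : A, ε := by simp
            _ ≤ _ := Finset.prod_le_prod (fun _ _ => h0) fun i _ => by
              cases η i
              · simp only [bitWeight, Bool.false_eq_true, if_false]
                linarith
              · simp [bitWeight]
        have hq0 : 0 ≤ q := pow_nonneg h0 d
        refine div_nonneg ?_ (by linarith)
        nlinarith
    · dsimp only
      rw [hff, ← mul_div_assoc, ← mul_div_assoc, ← add_div, eq_div_iff hne]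
      ring

/-- Independent `ε`-noisy bits, sorted into groups of at most `d` bits each (with some bits in no
group), have the law of `ξ` xored on each group with a common `ε ^ d`-noisy bit of that group, where
`ξ` is independent of these with weights `K`. -/
theorem exists_groupwise_noise {S κ : Type*} [Fintype S] [Fintype κ] [DecidableEq S]
    [DecidableEq κ]
    {ε : ℝ} (h0 : 0 ≤ ε) (h2 : ε ≤ 1 / 2) {d : ℕ} (grp : S → Option κ)
    (hgrp : ∀ c, Fintype.card {s // grp s = some c} ≤ d) :
    ∃ K : (S → Bool) → ℝ, (∀ ξ, 0 ≤ K ξ) ∧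
      ∀ η, bitsWeight ε η =
        ∑ z : κ → Bool, bitsWeight (ε ^ d) z * K fun s => xor (η s) ((grp s).elim false z) := by
  have h1 : ε ≤ 1 := by linarith
  choose K hK0 hK using fun c => exists_common_noise h0 h2 (hgrp c)
  refine ⟨fun ξ => (∏ s : {s // grp s = none}, bitWeight ε (ξ s)) *
    ∏ c, K c fun s => ξ s, fun ξ => ?_, fun η => ?_⟩
  · exact mul_nonneg (Finset.prod_nonneg fun i _ => bitWeight_nonneg h0 h1 _)
      (Finset.prod_nonneg fun c _ => hK0 c _)
  · have hsplit : bitsWeight ε η = (∏ s : {s // grp s = none}, bitWeight ε (η s)) *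
        ∏ c, bitsWeight ε fun s : {s // grp s = some c} => η s := by
      unfold bitsWeight
      rw [← Fintype.prod_fiberwise grp, Fintype.prod_option]
    rw [hsplit]
    simp only [hK]
    rw [Finset.prod_univ_sum, Finset.mul_sum]
    simp only [Fintype.piFinset_univ]
    refine Finset.sum_congr rfl fun z _ => ?_
    rw [Finset.prod_mul_distrib, mul_left_comm]
    unfold bitsWeight
    congr 1
    congr 1
    · refine Finset.prod_congr rfl fun s _ => ?_
      rw [s.2]
      simp
    · refine Finset.prod_congr rfl fun c _ => ?_
      congr 1
      funext s
      rw [s.2]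
      simp

/-- Replacing some of the noise bits by fresh ones does not change the law of the noise. -/
theorem sum_bitsWeight_resample {S : Type*} [Fintype S] [DecidableEq S] (ε : ℝ) (C : S → Prop)
    [DecidablePred C] (φ : (S → Bool) → ℝ) :
    ∑ p : (S → Bool) × (S → Bool), bitsWeight ε p.1 * bitsWeight ε p.2 *
        φ (fun s => if C s then p.2 s else p.1 s) = ∑ η, bitsWeight ε η * φ η := by
  let f : (S → Bool) × (S → Bool) → (S → Bool) × (S → Bool) := fun p =>
    (fun s => if C s then p.2 s else p.1 s, fun s => if C s then p.1 s else p.2 s)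
  have hf : Function.Involutive f := by
    intro p
    ext s <;> by_cases h : C s <;> simp [f, h]
  have hw : ∀ p, bitsWeight ε (f p).1 * bitsWeight ε (f p).2 =
      bitsWeight ε p.1 * bitsWeight ε p.2 := by
    intro p
    unfold bitsWeight
    rw [← Finset.prod_mul_distrib, ← Finset.prod_mul_distrib]
    refine Finset.prod_congr rfl fun s _ => ?_
    by_cases h : C s <;> simp [f, h, mul_comm]
  have h := Equiv.sum_comp (hf.toPerm f) (fun p => bitsWeight ε p.1 * bitsWeight ε p.2 * φ p.1)
  simp only [Function.Involutive.coe_toPerm, hw] at h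
  refine h.trans ?_
  rw [Fintype.sum_prod_type]
  refine Finset.sum_congr rfl fun η _ => ?_
  simp only [← Finset.sum_mul, ← Finset.mul_sum, sum_bitsWeight, mul_one]

/-- The two simulations combined: the noise at the positions of `C` is fresh, that at the other
positions comes from one `ε ^ d`-noisy bit per group. The weights `K` do not depend on `C`. -/
theorem exists_noise_simulation {S κ : Type*} [Fintype S] [Fintype κ] [DecidableEq S]
    [DecidableEq κ]
    {ε : ℝ} (h0 : 0 ≤ ε) (h2 : ε ≤ 1 / 2) {d : ℕ} (grp : S → Option κ)
    (hgrp : ∀ c, Fintype.card {s // grp s = some c} ≤ d) :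
    ∃ K : (S → Bool) × (S → Bool) → ℝ, (∀ r, 0 ≤ K r) ∧ ∑ r, K r = 1 ∧
      ∀ (C : S → Prop) [DecidablePred C] (φ : (S → Bool) → ℝ),
        ∑ η, bitsWeight ε η * φ η = ∑ r, K r * ∑ z : κ → Bool, bitsWeight (ε ^ d) z *
          φ fun s => if C s then r.2 s else xor (r.1 s) ((grp s).elim false z) := by
  obtain ⟨K, hK0, hK⟩ := exists_groupwise_noise h0 h2 grp hgrp
  have hshift : ∀ ψ : (S → Bool) → ℝ, ∑ η, bitsWeight ε η * ψ η =
      ∑ ξ, K ξ * ∑ z : κ → Bool, bitsWeight (ε ^ d) z *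
        ψ fun s => xor (ξ s) ((grp s).elim false z) := by
    intro ψ
    simp only [hK, Finset.sum_mul, Finset.mul_sum]
    rw [Finset.sum_comm]
    conv_rhs => rw [Finset.sum_comm]
    refine Finset.sum_congr rfl fun z _ => ?_
    let f : (S → Bool) → S → Bool := fun ξ s => xor (ξ s) ((grp s).elim false z)
    have hf : Function.Involutive f := by
      intro ξ
      ext s
      simp [f]
    rw [← Equiv.sum_comp (hf.toPerm f)]
    refine Finset.sum_congr rfl fun ξ _ => ?_
    have hff : (fun s : S => xor (hf.toPerm f ξ s) ((grp s).elim false z)) = ξ := hf ξ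
    rw [hff]
    simp only [Function.Involutive.coe_toPerm, f]
    ring
  have key : ∀ (C : S → Prop) [DecidablePred C] (φ : (S → Bool) → ℝ),
      ∑ η, bitsWeight ε η * φ η = ∑ r : (S → Bool) × (S → Bool), (K r.1 * bitsWeight ε r.2) *
        ∑ z : κ → Bool, bitsWeight (ε ^ d) z *
          φ fun s => if C s then r.2 s else xor (r.1 s) ((grp s).elim false z) := by
    intro C _ φ
    rw [← sum_bitsWeight_resample ε C φ]
    simp only [Fintype.sum_prod_type]
    rw [Finset.sum_comm]
    conv_rhs => rw [Finset.sum_comm]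
    refine Finset.sum_congr rfl fun η' _ => ?_
    simp only [mul_assoc]
    rw [hshift fun ξ => bitsWeight ε η' * φ fun s => if C s then η' s else ξ s]
    refine Finset.sum_congr rfl fun ξ _ => ?_
    congr 1
    rw [Finset.mul_sum]
    exact Finset.sum_congr rfl fun z _ => mul_left_comm _ _ _
  refine ⟨fun r => K r.1 * bitsWeight ε r.2, fun r => mul_nonneg (hK0 _)
    (bitsWeight_nonneg h0 (by linarith) _), ?_, key⟩
  have h := key (fun _ => False) (fun _ => 1)
  simpa [sum_bitsWeight] using h.symm

/-! ### Sums of products along a shared transcript -/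

/-- A game in which a sequence `τ` of `T` moves is chosen one by one, with payoff `G τ`. At the
steps of `own` the values of all continuations are added up; at the others the best one is taken. -/
noncomputable def gameValue {M : Type*} [Fintype M] [Nonempty M] :
    {T : ℕ} → (Fin T → Prop) → ((Fin T → M) → ℝ) → ℝ
  | 0, _, G => G Fin.elim0
  | _ + 1, own, G => open Classical in
    if own 0 then ∑ m, gameValue (fun t => own t.succ) fun τ => G (Fin.cons m τ)
    else Finset.univ.sup' Finset.univ_nonempty fun m =>
      gameValue (fun t => own t.succ) fun τ => G (Fin.cons m τ)

theorem gameValue_nonneg {M : Type*} [Fintype M] [Nonempty M] {T : ℕ} (own : Fin T → Prop)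
    {G : (Fin T → M) → ℝ} (hG : ∀ τ, 0 ≤ G τ) : 0 ≤ gameValue own G := by
  induction T with
  | zero => exact hG _
  | succ T ih =>
    unfold gameValue
    split_ifs
    · exact Finset.sum_nonneg fun m _ => ih _ fun τ => hG _
    · obtain ⟨m⟩ := ‹Nonempty M›
      exact (ih (fun t => own t.succ) fun τ => hG (Fin.cons m τ)).trans
        (Finset.le_sup' (fun m => gameValue (fun t => own t.succ) fun τ => G (Fin.cons m τ))
          (Finset.mem_univ m))

/-- If every step belongs to one player, then the sum of a product of payoffs is at most the product
of the values of the players, since each step is summed over in only one of the factors. -/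
theorem sum_prod_le_prod_gameValue {M J : Type*} [Fintype M] [Nonempty M] [Fintype J]
    [DecidableEq J] {T : ℕ} (owner : Fin T → J) {G : J → (Fin T → M) → ℝ}
    (hG : ∀ o τ, 0 ≤ G o τ) :
    ∑ τ, ∏ o, G o τ ≤ ∏ o, gameValue (fun t => owner t = o) (G o) := by
  induction T with
  | zero => simp [gameValue, Subsingleton.elim default Fin.elim0]
  | succ T ih =>
    have hv : ∀ o m, 0 ≤ gameValue (fun t => owner t.succ = o) fun τ => G o (Fin.cons m τ) :=
      fun o m => gameValue_nonneg _ fun τ => hG _ _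
    calc ∑ τ, ∏ o, G o τ
        = ∑ m, ∑ τ : Fin T → M, ∏ o, G o (Fin.cons m τ) := by
          rw [← Fintype.sum_prod_type', ← Equiv.sum_comp (Fin.consEquiv fun _ => M)]
          rfl
      _ ≤ ∑ m, ∏ o, gameValue (fun t => owner t.succ = o) fun τ => G o (Fin.cons m τ) :=
          Finset.sum_le_sum fun m _ => ih (fun t => owner t.succ) fun o τ => hG _ _
      _ ≤ ∑ m, gameValue (fun t => owner t.succ = owner 0) (fun τ => G (owner 0) (Fin.cons m τ)) *
            ∏ o ∈ Finset.univ.erase (owner 0), gameValue (fun t => owner t = o) (G o) := by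
          refine Finset.sum_le_sum fun m _ => ?_
          rw [← Finset.mul_prod_erase _ _ (Finset.mem_univ (owner 0))]
          refine mul_le_mul_of_nonneg_left (Finset.prod_le_prod (fun o _ => hv o m) ?_) (hv _ m)
          intro o ho
          rw [gameValue, if_neg (Finset.ne_of_mem_erase ho).symm]
          exact Finset.le_sup'
            (fun m => gameValue (fun t => owner t.succ = o) fun τ => G o (Fin.cons m τ))
            (Finset.mem_univ m)
      _ = ∏ o, gameValue (fun t => owner t = o) (G o) := by
          rw [← Finset.mul_prod_erase _ _ (Finset.mem_univ (owner 0)), ← Finset.sum_mul]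
          congr 1
          rw [gameValue, if_pos rfl]

/-! ### Realizing the value of a player by a tree -/

/-- Suppose the move at a step `t` of `own` must be `H t τ y`, for `y` the version of the input with
noise index `lam t`, where the `Bool → Bool`-valued function `H` uses only the moves before `t`.
The weight of a sequence of moves is the absolute value of the total weight of the outcomes `ω` of
input and noise that agree with it. Then the value of the game is at most the correlation of the
weight with the leaf of a binary tree that makes two queries for each step of `own`, namely for the
two values of `H t τ y`. Its query list depends on `own` alone. -/
theorem exists_tree_gameValue_le {Ω Λ : Type} [Fintype Ω] {n : ℕ}
    (X : Ω → Fin 1 → Fin n → Bool) (Z : Ω → Fin 1 × Λ × Fin n → Bool) {T : ℕ} (own : Fin T → Prop)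
    [DecidablePred own] :
    ∃ l : List (Fin 1), l.length = 2 * Finset.card {t | own t} ∧
      ∀ (lam : Fin T → Λ) (H : Fin T → (Fin T → Bool → Bool) → (Fin n → Bool) → Bool → Bool),
        (∀ t τ τ', (∀ s < t, τ s = τ' s) → H t τ = H t τ') → ∀ W : Ω → ℝ,
        ∃ (A : XndTree n 1 Λ l) (a : List ℕ → Set.Icc (-1 : ℝ) 1), A.IsBinary ∧
          gameValue own (fun τ => |∑ ω, W ω * propInd (∀ t, own t →
            H t τ (fun r => xor (X ω 0 r) (Z ω (0, lam t, r))) = τ t)|) ≤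
          ∑ ω, W ω * a (A.eval (X ω) (Z ω)) := by
  induction T with
  | zero =>
    refine ⟨[], by simp, fun lam H hH W => ?_⟩
    have hval : gameValue own (fun τ => |∑ ω, W ω * propInd (∀ t, own t →
        H t τ (fun r => xor (X ω 0 r) (Z ω (0, lam t, r))) = τ t)|) = |∑ ω, W ω| := by
      simp [gameValue, propInd]
    rw [hval]
    rcases abs_cases (∑ ω, W ω) with h | h
    · exact ⟨.leaf, fun _ => ⟨1, by norm_num⟩, trivial, by simp [h.1]⟩
    · exact ⟨.leaf, fun _ => ⟨-1, by norm_num⟩, trivial, by simp [h.1]⟩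
  | succ T ih =>
    obtain ⟨l, hl, h⟩ := ih fun t => own t.succ
    have hcausal : ∀ (H : Fin (T + 1) → (Fin (T + 1) → Bool → Bool) → (Fin n → Bool) → Bool → Bool),
        (∀ t τ τ', (∀ s < t, τ s = τ' s) → H t τ = H t τ') → ∀ m : Bool → Bool,
        ∀ (t : Fin T) (τ τ' : Fin T → Bool → Bool), (∀ s < t, τ s = τ' s) →
          H t.succ (Fin.cons m τ) = H t.succ (Fin.cons m τ') := by
      intro H hH m t τ τ' hτ
      refine hH _ _ _ fun s => ?_
      refine Fin.cases (fun _ => by simp) (fun s hs => ?_) s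
      simpa using hτ s (Fin.succ_lt_succ_iff.1 hs)
    by_cases hown : own 0
    · refine ⟨0 :: 0 :: l, ?_, fun lam H hH W => ?_⟩
      · rw [Fin.card_filter_univ_succ, if_pos hown]
        simp only [List.length_cons, hl]
        ring
      · let y : Ω → Fin n → Bool := fun ω r => xor (X ω 0 r) (Z ω (0, lam 0, r))
        let f : (Fin n → Bool) → Bool → Bool := H 0 fun _ => id
        choose A a hA ha using fun m => h (fun t => lam t.succ)
          (fun t τ => H t.succ (Fin.cons m τ)) (hcausal H hH m)
          (fun ω => W ω * propInd (f (y ω) = m))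
        -- The move at the first step is the pair of the answers to the first two queries.
        let dec : Fin 2 → Bool := fun c => decide (c = 1)
        let enc : Bool → Fin 2 := fun b => if b then 1 else 0
        have hdec : ∀ b, dec (enc b) = b := by decide
        let mk : Bool → Bool → Bool → Bool := fun b c e => if e then c else b
        let B : XndTree n 1 Λ (0 :: 0 :: l) :=
          .node 0 _ (lam 0) 2 (fun v => enc (f v false)) fun b =>
            .node 0 _ (lam 0) 2 (fun v => enc (f v true)) fun c => A (mk (dec b) (dec c))
        let e : List ℕ → Set.Icc (-1 : ℝ) 1 := fun L => match L with
          | b :: c :: L => a (mk (decide (b = 1)) (decide (c = 1))) L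
          | _ => ⟨0, by norm_num⟩
        have heval : ∀ ω, e (B.eval (X ω) (Z ω)) =
            a (f (y ω)) ((A (f (y ω))).eval (X ω) (Z ω)) := by
          intro ω
          have h1 : mk (f (y ω) false) (f (y ω) true) = f (y ω) := by
            funext b
            cases b <;> rfl
          have h2 : ∀ b, decide ((enc b).val = 1) = b := by decide
          simp only [B, XndTree.eval, e]
          change a (mk (decide ((enc (f (y ω) false)).val = 1))
            (decide ((enc (f (y ω) true)).val = 1)))
            ((A (mk (dec (enc (f (y ω) false))) (dec (enc (f (y ω) true))))).eval (X ω) (Z ω)) = _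
          rw [h2, h2, hdec, hdec, h1]
        refine ⟨B, e, ⟨rfl, fun b => ⟨rfl, fun c => hA _⟩⟩, ?_⟩
        rw [gameValue, if_pos hown]
        calc _ = ∑ m, _ := Finset.sum_congr rfl fun m _ => ?_
          _ ≤ ∑ m, ∑ ω, W ω * propInd (f (y ω) = m) * a m ((A m).eval (X ω) (Z ω)) :=
            Finset.sum_le_sum fun m _ => ha m
          _ = _ := ?_
        · congr 1
          funext τ
          congr 1
          refine Finset.sum_congr rfl fun ω _ => ?_
          rw [mul_assoc, ← propInd_and]
          congr 2
          rw [Fin.forall_fin_succ]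
          refine propext (and_congr ?_ ?_)
          · have : H 0 (Fin.cons m τ) = H 0 fun _ => id :=
              hH _ _ _ fun s hs => absurd hs (Fin.not_lt_zero s)
            rw [this]
            simp [hown, f, y]
          · simp
        · rw [Finset.sum_comm]
          refine Finset.sum_congr rfl fun ω _ => ?_
          rw [Finset.sum_eq_single (f (y ω)), propInd_true rfl, mul_one, heval]
          · intro m _ hm
            rw [propInd_false hm.symm]
            ring
          · simp
    · refine ⟨l, ?_, fun lam H hH W => ?_⟩
      · rw [Fin.card_filter_univ_succ, if_neg hown]
        simpa [Function.comp_def] using hl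
      · rw [gameValue, if_neg hown]
        obtain ⟨m, -, hm⟩ := Finset.exists_mem_eq_sup' Finset.univ_nonempty fun m =>
          gameValue (fun t => own t.succ) fun τ => |∑ ω, W ω * propInd (∀ t, own t →
            H t (Fin.cons m τ) (fun r => xor (X ω 0 r) (Z ω (0, lam t, r))) =
              (Fin.cons m τ : Fin (T + 1) → Bool → Bool) t)|
        rw [hm]
        obtain ⟨A, a, hA, ha⟩ := h (fun t => lam t.succ)
          (fun t τ => H t.succ (Fin.cons m τ)) (hcausal H hH m) W
        refine ⟨A, a, hA, le_of_eq_of_le ?_ ha⟩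
        congr 1
        funext τ
        congr 1
        refine Finset.sum_congr rfl fun ω _ => ?_
        congr 2
        rw [Fin.forall_fin_succ]
        simp [hown]

/-! ### Advantages -/

theorem abs_sum_le_one {S Ω : Type*} [Fintype S] [Fintype Ω] {f : S → ℝ} (hf : ∀ x, |f x| ≤ 1)
    (μ : PMF S) (ν : PMF Ω) {g : S → Ω → ℝ} (hg : ∀ x w, |g x w| ≤ 1) :
    |∑ x, ∑ w, (μ x).toReal * (ν w).toReal * (f x * g x w)| ≤ 1 := by
  calc |∑ x, ∑ w, (μ x).toReal * (ν w).toReal * (f x * g x w)|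
      ≤ ∑ x, ∑ w, |(μ x).toReal * (ν w).toReal * (f x * g x w)| :=
        (Finset.abs_sum_le_sum_abs _ _).trans
          (Finset.sum_le_sum fun x _ => Finset.abs_sum_le_sum_abs _ _)
    _ ≤ ∑ x, ∑ w, (μ x).toReal * (ν w).toReal := by
        refine Finset.sum_le_sum fun x _ => Finset.sum_le_sum fun w _ => ?_
        have h : 0 ≤ (μ x).toReal * (ν w).toReal :=
          mul_nonneg ENNReal.toReal_nonneg ENNReal.toReal_nonneg
        rw [abs_mul, abs_of_nonneg h, abs_mul]
        exact mul_le_of_le_one_right h (mul_le_one₀ (hf x) (abs_nonneg _) (hg x w))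
    _ = 1 := by
        simp only [← Finset.mul_sum, sum_toReal, mul_one]

section Advantage

variable {S Ω C : Type*} [Fintype S] [Fintype Ω] {f : S → ℝ}

theorem le_advantage (hf : ∀ x, |f x| ≤ 1) (μ : PMF S) (ν : PMF Ω) (A : S → Ω → C)
    (a : C → Set.Icc (-1 : ℝ) 1) :
    |∑ x, ∑ w, (μ x).toReal * (ν w).toReal * (f x * (a (A x w) : ℝ))| ≤ advantage f μ ν A := by
  refine le_ciSup (f := fun a : C → Set.Icc (-1 : ℝ) 1 =>
    |∑ x, ∑ w, (μ x).toReal * (ν w).toReal * (f x * (a (A x w) : ℝ))|) ⟨1, ?_⟩ a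
  rintro _ ⟨b, rfl⟩
  exact abs_sum_le_one hf μ ν fun x w => abs_le.2 (b _).2

theorem advantage_le {μ : PMF S} {ν : PMF Ω} {A : S → Ω → C} {B : ℝ}
    (h : ∀ a : C → Set.Icc (-1 : ℝ) 1,
      |∑ x, ∑ w, (μ x).toReal * (ν w).toReal * (f x * (a (A x w) : ℝ))| ≤ B) :
    advantage f μ ν A ≤ B :=
  haveI : Nonempty (C → Set.Icc (-1 : ℝ) 1) := ⟨fun _ => ⟨0, by norm_num⟩⟩
  ciSup_le h

end Advantage

/-- The parity of a block of bits, as a sign. -/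
noncomputable def blockSign {n : ℕ} (x : Fin n → Bool) : ℝ := ∏ i, if x i then (-1 : ℝ) else 1

theorem paritySign_eq_prod {n k : ℕ} (x : Fin k → Fin n → Bool) :
    paritySign x = ∏ j, blockSign (x j) := rfl

theorem abs_paritySign {n k : ℕ} (x : Fin k → Fin n → Bool) : |paritySign x| ≤ 1 := by
  unfold paritySign
  rw [Finset.abs_prod]
  refine Finset.prod_le_one (fun _ _ => abs_nonneg _) fun j _ => ?_
  rw [Finset.abs_prod]
  refine Finset.prod_le_one (fun _ _ => abs_nonneg _) fun i _ => ?_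
  split_ifs <;> simp

theorem XndTree.parityAdvantage_le_one {n k : ℕ} {Λ : Type} [Fintype Λ] [DecidableEq Λ]
    {l : List (Fin k)} (A : XndTree n k Λ l) (ε : unitInterval)
    (μ : PMF (Fin k → Fin n → Bool)) : A.parityAdvantage ε μ ≤ 1 :=
  advantage_le fun a => abs_sum_le_one abs_paritySign _ _ fun _ _ => abs_le.2 (a _).2

theorem XndTree.parityAdvantage_le_binaryXndAdvantage {n m D : ℕ} {μ : PMF (Fin n → Bool)}
    {ε : unitInterval} {l : List (Fin 1)} (A : XndTree n 1 (Fin m) l) (hA : A.IsBinary)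
    (hl : ∀ i, l.count i ≤ D) :
    A.parityAdvantage ε (iidLaw μ (Fin 1)) ≤ binaryXndAdvantage μ D ε := by
  refine le_csSup ⟨1, ?_⟩ ⟨m, l, A, hl, hA, rfl⟩
  rintro _ ⟨m, l, A, -, -, rfl⟩
  exact A.parityAdvantage_le_one _ _

theorem binaryXndAdvantage_nonneg {n : ℕ} (μ : PMF (Fin n → Bool)) (D : ℕ) (ε : unitInterval) :
    0 ≤ binaryXndAdvantage μ D ε :=
  ((abs_nonneg _).trans (le_advantage abs_paritySign _ _ _ fun _ => ⟨0, by norm_num⟩)).trans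
    ((XndTree.leaf : XndTree n 1 (Fin 0) []).parityAdvantage_le_binaryXndAdvantage trivial
      (by simp))

theorem binaryXndAdvantage_le_xndAdvantage {n : ℕ} (μ : PMF (Fin n → Bool)) (D : ℕ)
    (ε : unitInterval) : binaryXndAdvantage μ D ε ≤ xndAdvantage μ D ε := by
  refine csSup_le_csSup ⟨1, ?_⟩ ⟨_, 0, [], .leaf, by simp, trivial, rfl⟩ ?_
  · rintro _ ⟨m, l, A, -, rfl⟩
    exact A.parityAdvantage_le_one _ _
  · rintro _ ⟨m, l, A, hl, -, rfl⟩
    exact ⟨m, l, A, hl, rfl⟩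

/-- The value of the player who controls a block of the input: the weight of an outcome is its
probability times the sign of its block. -/
theorem gameValue_le_binaryXndAdvantage {n m D T : ℕ} (μ : PMF (Fin n → Bool)) (q : unitInterval)
    (own : Fin T → Prop) [DecidablePred own] (hown : 2 * Finset.card {t | own t} ≤ D)
    (lam : Fin T → Fin m) (H : Fin T → (Fin T → Bool → Bool) → (Fin n → Bool) → Bool → Bool)
    (hH : ∀ t τ τ', (∀ s < t, τ s = τ' s) → H t τ = H t τ') :
    gameValue own (fun τ => |∑ ω : (Fin n → Bool) × (Fin m × Fin n → Bool),
      ((μ ω.1).toReal * blockSign ω.1 * bitsWeight q ω.2) * propInd (∀ t, own t →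
        H t τ (fun i => xor (ω.1 i) (ω.2 (lam t, i))) = τ t)|) ≤ binaryXndAdvantage μ D q := by
  obtain ⟨l, hl, h⟩ := exists_tree_gameValue_le
    (fun ω : (Fin n → Bool) × (Fin m × Fin n → Bool) => fun _ => ω.1) (fun ω p => ω.2 p.2) own
  obtain ⟨A, a, hA, ha⟩ := h lam H hH fun ω =>
    (μ ω.1).toReal * blockSign ω.1 * bitsWeight q ω.2
  refine ha.trans (le_trans ?_ (A.parityAdvantage_le_binaryXndAdvantage hA fun i =>
    List.count_le_length.trans (hl.trans_le hown)))
  refine le_trans (le_of_eq ?_) ((le_abs_self _).trans (le_advantage abs_paritySign _ _ _ a))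
  rw [Fintype.sum_prod_type, ← Equiv.sum_comp (Equiv.funUnique (Fin 1) (Fin n → Bool))]
  refine Finset.sum_congr rfl fun x _ => ?_
  let e : (Fin 1 × Fin m × Fin n → Bool) ≃ (Fin m × Fin n → Bool) :=
    (Equiv.uniqueProd (Fin m × Fin n) (Fin 1)).arrowCongr (Equiv.refl Bool)
  rw [← Equiv.sum_comp e]
  refine Finset.sum_congr rfl fun z _ => ?_
  have hx : (fun _ : Fin 1 => Equiv.funUnique (Fin 1) (Fin n → Bool) x) = x := by
    funext j
    rw [Subsingleton.elim j default]
    rfl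
  have hz : (fun p : Fin 1 × Fin m × Fin n => e z p.2) = z := by
    funext p
    obtain ⟨j, p⟩ := p
    rw [Subsingleton.elim j default]
    rfl
  have hw : bitsWeight (q : ℝ) (e z) = bitsWeight (q : ℝ) z := by
    unfold bitsWeight
    rw [← Equiv.prod_comp (Equiv.uniqueProd (Fin m × Fin n) (Fin 1))]
    refine Finset.prod_congr rfl fun p _ => ?_
    conv_rhs => rw [← hz]
    rfl
  simp only [hx, hz, hw, iidLaw_toReal μ, iidLaw_noisyBit_toReal, paritySign_eq_prod,
    Fin.prod_univ_one]
  have : Equiv.funUnique (Fin 1) (Fin n → Bool) x = x 0 := rfl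
  rw [this]
  ring

/-- The value of a player who receives no input is at most the probability, one, that some
transcript agrees with the player. -/
theorem gameValue_propInd_le_one {T : ℕ} (own : Fin T → Prop) [DecidablePred own]
    (H : Fin T → (Fin T → Bool → Bool) → Bool → Bool)
    (hH : ∀ t τ τ', (∀ s < t, τ s = τ' s) → H t τ = H t τ') :
    gameValue own (fun τ => propInd (∀ t, own t → H t τ = τ t)) ≤ 1 := by
  obtain ⟨l, -, h⟩ := exists_tree_gameValue_le (Λ := Unit) (n := 0)
    (fun _ : Unit => fun _ _ => false) (fun _ _ => false) own
  obtain ⟨A, a, -, ha⟩ := h (fun _ => ()) (fun t τ _ => H t τ)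
    (fun t τ τ' h => by simp only [hH t τ τ' h]) fun _ => 1
  simp only [Finset.univ_unique, Finset.sum_singleton, one_mul] at ha
  have hind : ∀ p, |propInd p| = propInd p := fun p => by
    by_cases h : p <;> simp [propInd, h]
  simp only [hind] at ha
  exact ha.trans (a _).2.2

/-! ### Transcripts of a protocol -/

namespace NoisyProtocol

variable {V : Type*} {G : SimpleGraph V} {R : Type*} (P : NoisyProtocol G R)

/-- The message at step `t`, as a function of the sender's own bit, if the message functions of the
earlier steps are `τ`, the nodes hold the bits `input`, and the noise is `η`. -/
def messageFunction (ρ : R) (input : V → Bool) (η : V × Fin P.cost → Bool) (t : Fin P.cost)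
    (τ : Fin P.cost → Bool → Bool) : Bool → Bool := fun b =>
  P.message t ρ b fun s => xor (τ s.1 (input (P.sender s.1))) (η (P.sender t, s.1))

/-- The sequence of the message functions in a run of the protocol. -/
def transcript (ρ : R) (input : V → Bool) (η : V × Fin P.cost → Bool) :
    Fin P.cost → Bool → Bool := fun t b =>
  P.message t ρ b fun s => xor (P.sentBit ρ input η s.1) (η (P.sender t, s.1))

theorem transcript_apply_input (ρ : R) (input : V → Bool) (η : V × Fin P.cost → Bool)
    (t : Fin P.cost) :
    P.transcript ρ input η t (input (P.sender t)) = P.sentBit ρ input η t := by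
  rw [sentBit, transcript]

theorem messageFunction_eq_iff (ρ : R) (input : V → Bool) (η : V × Fin P.cost → Bool)
    (τ : Fin P.cost → Bool → Bool) :
    (∀ t, P.messageFunction ρ input η t τ = τ t) ↔ τ = P.transcript ρ input η := by
  constructor
  · intro h
    funext t
    induction t using WellFoundedLT.induction with
    | ind t ih =>
      rw [← h t]
      funext b
      unfold messageFunction transcript
      congr 1
      funext s
      rw [ih s.1 s.2.1, transcript_apply_input]
  · rintro rfl t
    funext b
    simp only [messageFunction, transcript_apply_input]
    rfl

/-- An expectation over the noise of a function of the transcript, as a sum over transcripts. -/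
theorem apply_transcript_eq_sum (ρ : R) (input : V → Bool) (η : V × Fin P.cost → Bool)
    (a : (Fin P.cost → Bool → Bool) → ℝ) :
    a (P.transcript ρ input η) =
      ∑ τ, a τ * propInd (∀ t, P.messageFunction ρ input η t τ = τ t) := by
  rw [Finset.sum_eq_single (P.transcript ρ input η)]
  · rw [propInd_true ((P.messageFunction_eq_iff ρ input η _).2 rfl), mul_one]
  · intro τ _ hτ
    rw [propInd_false fun h => hτ ((P.messageFunction_eq_iff ρ input η _).1 h), mul_zero]
  · simp

end NoisyProtocol

/-! ### Message functions from noisy versions of the input -/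

namespace NetworkDecomposition

variable {V : Type*} {G : SimpleGraph V} {n k : ℕ} (N : NetworkDecomposition G n k)

/-- The pair `(j, i)` if `v` is the `i`-th node of `I_j`, and `none` for auxiliary nodes. -/
noncomputable def inputIndex (v : V) : Option (Fin k × Fin n) :=
  Function.partialInv (fun p : Fin k × Fin n => N.inputNode p.1 p.2) v

theorem inputIndex_eq_some {v : V} {j : Fin k} {i : Fin n} :
    N.inputIndex v = some (j, i) ↔ N.inputNode j i = v :=
  N.inputNode_injective.isPartialInv (j, i) v

/-- The bit held by the node `v` if the block of the input that `v` may belong to is `y`. -/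
noncomputable def heldBit (aux : V → Bool) (y : Fin n → Bool) (v : V) : Bool :=
  (N.inputIndex v).elim (aux v) fun p => y p.2

theorem extendInput_inputNode (aux : V → Bool) (x : Fin k → Fin n → Bool) (j : Fin k) (i : Fin n) :
    N.extendInput aux x (N.inputNode j i) = x j i :=
  N.inputNode_injective.extend_apply (fun p : Fin k × Fin n => x p.1 p.2) aux (j, i)

theorem extendInput_of_isAux {v : V} (hv : N.IsAux v) (aux : V → Bool)
    (x : Fin k → Fin n → Bool) : N.extendInput aux x v = aux v :=
  Function.extend_apply' _ _ _ fun ⟨p, hp⟩ => hv p.1 p.2 hp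

variable {R : Type*} (P : NoisyProtocol G R)

/-- The message function of step `t` if the earlier ones are `τ` and the sender knows the version
`y` of its block of the input. The noise on a bit comes from `r.2` if the bit does not depend on the
node that sent it, and otherwise from `r.1`, on top of the noise already present in `y`. -/
noncomputable def viewMessageFunction (aux : V → Bool) (ρ : R)
    (r : (V × Fin P.cost → Bool) × (V × Fin P.cost → Bool)) (t : Fin P.cost)
    (τ : Fin P.cost → Bool → Bool) (y : Fin n → Bool) : Bool → Bool := fun b =>
  P.message t ρ b fun s => xor (τ s.1 (N.heldBit aux y (P.sender s.1)))
    (if τ s.1 false = τ s.1 true then r.2 (P.sender t, s.1) else r.1 (P.sender t, s.1))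

theorem viewMessageFunction_congr (aux : V → Bool) (ρ : R)
    (r : (V × Fin P.cost → Bool) × (V × Fin P.cost → Bool)) (t : Fin P.cost)
    (τ τ' : Fin P.cost → Bool → Bool) (h : ∀ s < t, τ s = τ' s) :
    N.viewMessageFunction P aux ρ r t τ = N.viewMessageFunction P aux ρ r t τ' := by
  funext y b
  unfold viewMessageFunction
  congr 1
  funext s
  rw [h s.1 s.2.1]

/-- The noisy version of its block of the input that is used by the node `v`. Nodes outside the
clusters have no input neighbours, so for them any value will do. -/
def noisyView {Λ : Type*} (e : V → Λ) (x : Fin k → Fin n → Bool) (z : Fin k × Λ × Fin n → Bool)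
    (v : V) : Fin n → Bool :=
  (N.cluster v).elim (fun _ => false) fun j i => xor (x j i) (z (j, e v, i))

/-- The common noise bit that is used for the copy of transmission `p.2` received by `p.1`, if this
transmission comes from an input node in the cluster of `p.1`. -/
noncomputable def noiseGroup {Λ : Type*} (e : V → Λ) (p : V × Fin P.cost) :
    Option (Fin k × Λ × Fin n) :=
  (N.inputIndex (P.sender p.2)).bind fun c =>
    if N.cluster p.1 = some c.1 then some (c.1, e p.1, c.2) else none

theorem noiseGroup_eq_some {Λ : Type*} {e : V → Λ} {p : V × Fin P.cost} {j : Fin k} {i : Fin n}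
    {u : Λ} (h : N.noiseGroup P e p = some (j, u, i)) :
    P.sender p.2 = N.inputNode j i ∧ e p.1 = u := by
  unfold noiseGroup at h
  rw [Option.bind_eq_some_iff] at h
  obtain ⟨⟨j', i'⟩, h1, h2⟩ := h
  split_ifs at h2
  simp only [Option.some.injEq, Prod.mk.injEq] at h2
  obtain ⟨rfl, rfl, rfl⟩ := h2
  exact ⟨(N.inputIndex_eq_some.1 h1).symm, rfl⟩

theorem card_noiseGroup_le [Fintype V] [DecidableEq V] {Λ : Type*} [DecidableEq Λ] {e : V → Λ}
    (he : Function.Injective e) {d D : ℕ} (hP : N.IsBounded P d D) (c : Fin k × Λ × Fin n) :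
    Fintype.card {p // N.noiseGroup P e p = some c} ≤ d := by
  obtain ⟨j, u, i⟩ := c
  refine le_trans ?_ (hP.1 j i)
  rw [← Nat.card_eq_fintype_card, ← Nat.card_coe_set_eq]
  refine Nat.card_le_card_of_injective
    (fun p => ⟨p.1.2, (N.noiseGroup_eq_some P p.2).1⟩) fun p p' h => ?_
  have h2 : p.1.2 = p'.1.2 := congrArg Subtype.val h
  have h1 : p.1.1 = p'.1.1 :=
    he ((N.noiseGroup_eq_some P p.2).2.trans (N.noiseGroup_eq_some P p'.2).2.symm)
  exact Subtype.ext (Prod.ext h1 h2)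

/-- For a message function `m` that depends on its argument, `m b ⊕ e` equals `m (b ⊕ e)`; so noise
on the messages of an input node can be moved to its input bit. -/
theorem messageFunction_eq_viewMessageFunction {Λ : Type*} (e : V → Λ) (aux : V → Bool) (ρ : R)
    (x : Fin k → Fin n → Bool) (z : Fin k × Λ × Fin n → Bool)
    (r : (V × Fin P.cost → Bool) × (V × Fin P.cost → Bool)) (τ : Fin P.cost → Bool → Bool)
    (t : Fin P.cost) :
    P.messageFunction ρ (N.extendInput aux x)
      (fun p => if τ p.2 false = τ p.2 true then r.2 p else
        xor (r.1 p) ((N.noiseGroup P e p).elim false z)) t τ =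
    N.viewMessageFunction P aux ρ r t τ (N.noisyView e x z (P.sender t)) := by
  funext b
  unfold NoisyProtocol.messageFunction viewMessageFunction
  congr 1
  funext s
  dsimp only
  by_cases hC : τ s.1 false = τ s.1 true
  · have hconst : ∀ b, τ s.1 b = τ s.1 false := by
      intro b
      cases b
      · rfl
      · exact hC.symm
    rw [if_pos hC, if_pos hC, hconst, hconst (N.heldBit _ _ _)]
  · rw [if_neg hC, if_neg hC]
    have hflip : ∀ m : Bool → Bool, ¬m false = m true → ∀ b c u : Bool,
        xor (m b) (xor u c) = xor (m (xor b c)) u := by decide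
    cases hidx : N.inputIndex (P.sender s.1) with
    | none =>
      have haux : N.IsAux (P.sender s.1) := fun j i h => by
        rw [N.inputIndex_eq_some.2 h] at hidx
        cases hidx
      rw [N.extendInput_of_isAux haux]
      simp [noiseGroup, heldBit, hidx]
    | some c =>
      obtain ⟨j, i⟩ := c
      have hnode := N.inputIndex_eq_some.1 hidx
      have hcl : N.cluster (P.sender t) = some j :=
        N.cluster_neighbor j i _ (by rw [hnode]; exact s.2.2)
      simp only [noiseGroup, heldBit, noisyView, hidx, hcl, Option.bind_some, Option.elim_some,
        if_true]
      rw [hflip _ hC, ← hnode, N.extendInput_inputNode]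

end NetworkDecomposition

/-! ### The advantage of a protocol -/

/-- Summation over an input and a noise vector factors over the blocks. -/
theorem sum_sum_prod_blocks {A B : Type*} [Fintype A] [Fintype B] [DecidableEq B] {k : ℕ}
    (f : Fin k → A → (B → Bool) → ℝ) :
    ∑ x : Fin k → A, ∑ z : Fin k × B → Bool, ∏ j, f j (x j) (fun b => z (j, b)) =
      ∏ j, ∑ ω : A × (B → Bool), f j ω.1 ω.2 := by
  rw [Finset.prod_univ_sum, Fintype.piFinset_univ, ← Fintype.sum_prod_type']
  let e : (Fin k → A × (B → Bool)) ≃ (Fin k → A) × (Fin k × B → Bool) :=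
    (Equiv.arrowProdEquivProdArrow (Fin k) (fun _ => A) (fun _ => B → Bool)).trans
      ((Equiv.refl _).prodCongr (Equiv.curry (Fin k) B Bool).symm)
  rw [← Equiv.sum_comp e]
  rfl

theorem bitsWeight_blocks {B : Type*} [Fintype B] {k : ℕ} (q : ℝ) (z : Fin k × B → Bool) :
    bitsWeight q z = ∏ j, bitsWeight q fun b => z (j, b) :=
  Fintype.prod_prod_type _

section ProtocolBound

variable {V R : Type*} {G : SimpleGraph V} {n k m : ℕ} (N : NetworkDecomposition G n k)
  (aux : V → Bool) (P : NoisyProtocol G R) (e : V → Fin m) (μ : PMF (Fin n → Bool)) (q : ℝ) (ρ : R)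
  (r : (V × Fin P.cost → Bool) × (V × Fin P.cost → Bool))

/-- The contribution of one cluster, or of the nodes outside the clusters, to the correlation of the
parity with the transcript `τ`. -/
noncomputable def clusterFactor (τ : Fin P.cost → Bool → Bool) : Option (Fin k) → ℝ
  | none => propInd (∀ t, N.cluster (P.sender t) = none →
      N.viewMessageFunction P aux ρ r t τ (fun _ => false) = τ t)
  | some j => ∑ ω : (Fin n → Bool) × (Fin m × Fin n → Bool),
      ((μ ω.1).toReal * blockSign ω.1 * bitsWeight q ω.2) *
        propInd (∀ t, N.cluster (P.sender t) = some j →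
          N.viewMessageFunction P aux ρ r t τ
            (fun i => xor (ω.1 i) (ω.2 (e (P.sender t), i))) = τ t)

theorem sum_sum_eq_prod_clusterFactor (τ : Fin P.cost → Bool → Bool) :
    ∑ x : Fin k → Fin n → Bool, ∑ z : Fin k × Fin m × Fin n → Bool,
      (iidLaw μ (Fin k) x).toReal * paritySign x * bitsWeight q z *
        propInd (∀ t, N.viewMessageFunction P aux ρ r t τ (N.noisyView e x z (P.sender t)) = τ t) =
      ∏ o, clusterFactor N aux P e μ q ρ r τ o := by
  have hsplit : ∀ (x : Fin k → Fin n → Bool) (z : Fin k × Fin m × Fin n → Bool),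
      propInd (∀ t, N.viewMessageFunction P aux ρ r t τ (N.noisyView e x z (P.sender t)) = τ t) =
      clusterFactor N aux P e μ q ρ r τ none *
        ∏ j, propInd (∀ t, N.cluster (P.sender t) = some j →
          N.viewMessageFunction P aux ρ r t τ
            (fun i => xor (x j i) (z (j, e (P.sender t), i))) = τ t) := by
    intro x z
    rw [clusterFactor, ← propInd_forall, ← propInd_and]
    congr 1
    refine propext ⟨fun h => ⟨fun t ht => ?_, fun j t ht => ?_⟩, fun h t => ?_⟩
    · rw [← h t]
      simp [NetworkDecomposition.noisyView, ht]
    · rw [← h t]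
      simp [NetworkDecomposition.noisyView, ht]
    · cases hc : N.cluster (P.sender t) with
      | none => simpa [NetworkDecomposition.noisyView, hc] using h.1 t hc
      | some j => simpa [NetworkDecomposition.noisyView, hc] using h.2 j t hc
  rw [Fintype.prod_option]
  simp only [clusterFactor]
  rw [← sum_sum_prod_blocks (fun j (x : Fin n → Bool) (z : Fin m × Fin n → Bool) =>
      ((μ x).toReal * blockSign x * bitsWeight q z) *
        propInd (∀ t, N.cluster (P.sender t) = some j →
          N.viewMessageFunction P aux ρ r t τ
            (fun i => xor (x i) (z (e (P.sender t), i))) = τ t)), Finset.mul_sum]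
  refine Finset.sum_congr rfl fun x _ => ?_
  rw [Finset.mul_sum]
  refine Finset.sum_congr rfl fun z _ => ?_
  rw [hsplit, clusterFactor, iidLaw_toReal, paritySign_eq_prod, bitsWeight_blocks]
  simp only [Finset.prod_mul_distrib]
  ring

/-- For a fixed choice of the randomness that does not touch the input, the correlations of the
parity with all transcripts have total size at most `α ^ k`. -/
theorem sum_prod_abs_clusterFactor_le [Fintype V] {d D : ℕ} (q : unitInterval)
    (hP : N.IsBounded P d D) :
    ∑ τ, ∏ o, |clusterFactor N aux P e μ q ρ r τ o| ≤ binaryXndAdvantage μ (3 * D) q ^ k := by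
  have hcausal := N.viewMessageFunction_congr P aux ρ r
  refine (sum_prod_le_prod_gameValue (fun t => N.cluster (P.sender t))
    fun o τ => abs_nonneg (clusterFactor N aux P e μ q ρ r τ o)).trans ?_
  rw [Fintype.prod_option]
  have hnone : gameValue (fun t => N.cluster (P.sender t) = none)
      (fun τ => |clusterFactor N aux P e μ q ρ r τ none|) ≤ 1 := by
    refine le_of_eq_of_le ?_ (gameValue_propInd_le_one
      (fun t => N.cluster (P.sender t) = none)
      (fun t τ => N.viewMessageFunction P aux ρ r t τ fun _ => false)
      fun t τ τ' h => by rw [hcausal t τ τ' h])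
    congr 1
    funext τ
    unfold clusterFactor propInd
    split_ifs <;> simp
  have hsome : ∀ j, gameValue (fun t => N.cluster (P.sender t) = some j)
      (fun τ => |clusterFactor N aux P e μ q ρ r τ (some j)|) ≤
        binaryXndAdvantage μ (3 * D) q := by
    intro j
    refine gameValue_le_binaryXndAdvantage μ q _ ?_ (fun t => e (P.sender t)) _ hcausal
    have h := hP.2 j
    rw [Set.ncard_eq_toFinset_card', Set.toFinset_ofPred] at h
    omega
  have h0 : ∀ o, 0 ≤ gameValue (fun t => N.cluster (P.sender t) = o)
      (fun τ => |clusterFactor N aux P e μ q ρ r τ o|) :=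
    fun o => gameValue_nonneg _ fun τ => abs_nonneg _
  calc _ ≤ 1 * ∏ _j : Fin k, binaryXndAdvantage μ (3 * D) q :=
        mul_le_mul hnone (Finset.prod_le_prod (fun j _ => h0 _) fun j _ => hsome j)
          (Finset.prod_nonneg fun j _ => h0 _) zero_le_one
    _ = _ := by simp

end ProtocolBound

/-- The expectation over the noise of a function of the transcript, with all noise replaced by
randomness `r` that does not depend on the input, and `ε ^ d`-noisy versions of the input. -/
theorem exists_transcript_simulation {V R : Type*} [Fintype V] [DecidableEq V] {G : SimpleGraph V}
    {n k m d D : ℕ} (N : NetworkDecomposition G n k) (aux : V → Bool) (P : NoisyProtocol G R)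
    {e : V → Fin m} (he : Function.Injective e) {ε : ℝ} (h0 : 0 ≤ ε) (h2 : ε ≤ 1 / 2)
    (hP : N.IsBounded P d D) :
    ∃ K : (V × Fin P.cost → Bool) × (V × Fin P.cost → Bool) → ℝ, (∀ r, 0 ≤ K r) ∧ ∑ r, K r = 1 ∧
      ∀ (ρ : R) (x : Fin k → Fin n → Bool) (a : (Fin P.cost → Bool → Bool) → ℝ),
        ∑ η, bitsWeight ε η * a (P.transcript ρ (N.extendInput aux x) η) =
        ∑ r, K r * ∑ τ, a τ * ∑ z : Fin k × Fin m × Fin n → Bool, bitsWeight (ε ^ d) z *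
          propInd (∀ t,
            N.viewMessageFunction P aux ρ r t τ (N.noisyView e x z (P.sender t)) = τ t) := by
  obtain ⟨K, hK0, hK1, hK⟩ := exists_noise_simulation h0 h2 (N.noiseGroup P e)
    (N.card_noiseGroup_le P he hP)
  refine ⟨K, hK0, hK1, fun ρ x a => ?_⟩
  calc ∑ η, bitsWeight ε η * a (P.transcript ρ (N.extendInput aux x) η)
      = ∑ τ, a τ * ∑ η, bitsWeight ε η *
          propInd (∀ t, P.messageFunction ρ (N.extendInput aux x) η t τ = τ t) := by
        simp only [P.apply_transcript_eq_sum, Finset.mul_sum]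
        rw [Finset.sum_comm]
        exact Finset.sum_congr rfl fun τ _ => Finset.sum_congr rfl fun η _ => mul_left_comm _ _ _
    _ = ∑ τ, a τ * ∑ r, K r * ∑ z : Fin k × Fin m × Fin n → Bool, bitsWeight (ε ^ d) z *
          propInd (∀ t,
            N.viewMessageFunction P aux ρ r t τ (N.noisyView e x z (P.sender t)) = τ t) := by
        refine Finset.sum_congr rfl fun τ _ => ?_
        rw [hK fun p => τ p.2 false = τ p.2 true]
        simp only [N.messageFunction_eq_viewMessageFunction]
    _ = _ := by
        simp only [Finset.mul_sum]
        rw [Finset.sum_comm]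
        refine Finset.sum_congr rfl fun r _ => Finset.sum_congr rfl fun τ _ =>
          Finset.sum_congr rfl fun z _ => mul_left_comm _ _ _

theorem abs_average_le {ι : Type*} [Fintype ι] {p f : ι → ℝ} {B : ℝ} (hp : ∀ i, 0 ≤ p i)
    (hp1 : ∑ i, p i = 1) (hf : ∀ i, |f i| ≤ B) : |∑ i, p i * f i| ≤ B :=
  calc |∑ i, p i * f i| ≤ ∑ i, p i * B :=
        (Finset.abs_sum_le_sum_abs _ _).trans (Finset.sum_le_sum fun i _ => by
          rw [abs_mul, abs_of_nonneg (hp i)]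
          exact mul_le_mul_of_nonneg_left (hf i) (hp i))
    _ = B := by rw [← Finset.sum_mul, hp1, one_mul]

theorem protocolAdvantage_le_binaryXndAdvantage_pow {V R : Type*} [Fintype V] [DecidableEq V]
    [Fintype R] {n k d D : ℕ} {ε : unitInterval} (hε : (ε : ℝ) ≤ 1 / 2) (μ : PMF (Fin n → Bool))
    {G : SimpleGraph V} (N : NetworkDecomposition G n k) (aux : V → Bool)
    (P : NoisyProtocol G R) (hP : N.IsBounded P d D) (hout : N.IsAux (P.sender P.lastStep)) :
    protocolAdvantage N aux P ε (iidLaw μ (Fin k)) ≤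
      binaryXndAdvantage μ (3 * D) (ε ^ d) ^ k := by
  refine advantage_le fun a => ?_
  let e := Fintype.equivFin V
  obtain ⟨K, hK0, hK1, hK⟩ := exists_transcript_simulation N aux P e.injective ε.2.1 hε hP
  set α := binaryXndAdvantage μ (3 * D) (ε ^ d)
  -- The node that answers is auxiliary, so the answer is a function of the transcript.
  let out : (Fin P.cost → Bool → Bool) → ℝ := fun τ =>
    a (τ P.lastStep (aux (P.sender P.lastStep)))
  have hans : ∀ ρ x η, (a (P.sentBit ρ (N.extendInput aux x) η P.lastStep) : ℝ) =
      out (P.transcript ρ (N.extendInput aux x) η) := by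
    intro ρ x η
    rw [← P.transcript_apply_input, N.extendInput_of_isAux hout]
  have hq : ((ε ^ d : unitInterval) : ℝ) = (ε : ℝ) ^ d := by simp
  have hmain : (∑ x, ∑ w : R × (V × Fin P.cost → Bool), (iidLaw μ (Fin k) x).toReal *
      (indepPair P.randomness (iidLaw (noisyBit ε) (V × Fin P.cost)) w).toReal *
        (paritySign x * (a (P.sentBit w.1 (N.extendInput aux x) w.2 P.lastStep) : ℝ))) =
      ∑ ρ, (P.randomness ρ).toReal * ∑ r, K r * ∑ τ, out τ *
        ∏ o, clusterFactor N aux P e μ (ε ^ d : unitInterval) ρ r τ o := by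
    calc _ = ∑ x, ∑ ρ, (iidLaw μ (Fin k) x).toReal * (P.randomness ρ).toReal * paritySign x *
          ∑ η, bitsWeight ε η * out (P.transcript ρ (N.extendInput aux x) η) := by
          refine Finset.sum_congr rfl fun x _ => ?_
          rw [Fintype.sum_prod_type]
          refine Finset.sum_congr rfl fun ρ _ => ?_
          rw [Finset.mul_sum]
          refine Finset.sum_congr rfl fun η _ => ?_
          rw [indepPair_toReal, iidLaw_noisyBit_toReal, hans]
          ring
      _ = _ := by
          simp only [hK, ← sum_sum_eq_prod_clusterFactor, Finset.mul_sum]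
          rw [Finset.sum_comm]
          refine Finset.sum_congr rfl fun ρ _ => ?_
          rw [Finset.sum_comm]
          refine Finset.sum_congr rfl fun r _ => ?_
          rw [Finset.sum_comm]
          refine Finset.sum_congr rfl fun τ _ => Finset.sum_congr rfl fun x _ =>
            Finset.sum_congr rfl fun z _ => ?_
          rw [hq]
          ring
  have hbound : ∀ ρ r, |∑ τ, out τ *
      ∏ o, clusterFactor N aux P e μ (ε ^ d : unitInterval) ρ r τ o| ≤ α ^ k := by
    intro ρ r
    refine le_trans ?_ (sum_prod_abs_clusterFactor_le N aux P e μ ρ r (ε ^ d) hP)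
    refine (Finset.abs_sum_le_sum_abs _ _).trans (Finset.sum_le_sum fun τ _ => ?_)
    rw [abs_mul, Finset.abs_prod]
    exact mul_le_of_le_one_left (Finset.prod_nonneg fun _ _ => abs_nonneg _) (abs_le.2 (a _).2)
  rw [hmain]
  exact abs_average_le (fun ρ => ENNReal.toReal_nonneg) (sum_toReal _) fun ρ =>
    abs_average_le hK0 hK1 (hbound ρ)

theorem mainTheorem2 {V R : Type*} [Fintype V] [DecidableEq V] [Fintype R]
    (n k d D : ℕ) (ε : unitInterval) (hε : (ε : ℝ) ≤ 1 / 2) (μ : PMF (Fin n → Bool))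
    (G : SimpleGraph V) (N : NetworkDecomposition G n k) (aux : V → Bool)
    (P : NoisyProtocol G R) (hP : N.IsBounded P d D)
    (hout : N.IsAux (P.sender P.lastStep)) :
    protocolAdvantage N aux P ε (iidLaw μ (Fin k)) ≤ xndAdvantage μ (3 * D) (ε ^ d) ^ k ∧
    protocolAdvantage N aux P ε (iidLaw μ (Fin k)) ≤ binaryXndAdvantage μ (3 * D) (ε ^ d) ^ k := by
  have h := protocolAdvantage_le_binaryXndAdvantage_pow hε μ N aux P hP hout
  exact ⟨h.trans (pow_le_pow_left₀ (binaryXndAdvantage_nonneg _ _ _)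
    (binaryXndAdvantage_le_xndAdvantage _ _ _) k), h⟩
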